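/- Let $q\in\mathbb C$ with $q\ne 0$ and $q\neq\pm1$, and let $q^{1/2}$ be any square root of $q$. Let $H=\mathrm{SL}_q(2)$ be the unital $\mathbb C$-algebra generated by $\alpha,\beta,\gamma,\delta$ subject to $$\beta\alpha=q\alpha\beta,\quad \gamma\alpha=q\alpha\gamma,\quad \delta\beta=q\beta\delta,\quad \delta\gamma=q\gamma\delta,\quad \gamma\beta=\beta\gamma,\quad \alpha\delta-\delta\alpha=(q^{-1}-q)\beta\gamma,\quad \alpha\delta-q^{-1}\beta\gamma=1 .$$ It is a bialgebra with multiplication $m$, unit $u$, and comultiplication and counit the algebra maps given by $\Delta(t_{ij})=\sum_k t_{ik}\otimes t_{kj}$, $\varepsilon(t_{ij})=1$ if $i=j$ and $0$ otherwise, where $(t_{ij})=\begin{pmatrix}\alpha&\beta\\ \gamma&\delta\end{pmatrix}$. It is coquasitriangular with the universal $\mathcal R$-form $\mathcal R:H\otimes H\to\mathbb C$, that is, the convolution invertible linear map satisfying, for all $a,b,c\in H$ in Sweedler notation, $\mathcal R(a_1\otimes b_1)a_2b_2=b_1a_1\mathcal R(a_2\otimes b_2)$, $\mathcal R(a\otimes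 bc)=\mathcal R(a_1\otimes c)\mathcal R(a_2\otimes b)$ and $\mathcal R(ab\otimes c)=\mathcal R(a\otimes c_1)\mathcal R(b\otimes c_2)$, determined on generators by $$\mathcal R(\alpha\otimes\alpha)=\mathcal R(\delta\otimes\delta)=q^{-1/2}q,\quad \mathcal R(\alpha\otimes\delta)=\mathcal R(\delta\otimes\alpha)=q^{-1/2},\quad \mathcal R(\beta\otimes\gamma)=q^{-1/2}(q-q^{-1}),$$ and $\mathcal R=0$ on all other pairs of generators. An infinitesimal $\mathcal R$-form on $(H,\mathcal R)$ is a linear map $\chi:H\otimes H\to\mathbb C$ such that $$(u\chi)*m=m*(u\chi),\qquad \chi(\mathrm{Id}\otimes m)=\chi_{12}+\mathcal R^{-1}_{12}*\chi_{13}*\mathcal R_{12},\qquad \chi(m\otimes\mathrm{Id})=\chi_{23}+\mathcal R^{-1}_{23}*\chi_{13}*\mathcal R_{23},$$ where $*$ is the convolution product, $\mathcal R^{-1}$ is the convolution inverse of $\mathcal R$, and $f_{12}(a\otimes b\otimes c)=f(a\otimes b)\varepsilon(c)$, $f_{23}(a\otimes b\otimes c)=\varepsilon(a)f(b\otimes c)$,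 $f_{13}(a\otimes b\otimes c)=\varepsilon(b)f(a\otimes c)$. Then a linear map $\chi:H\otimes H\to\mathbb C$ is an infinitesimal $\mathcal R$-form on $(\mathrm{SL}_q(2),\mathcal R)$ if and only if $\chi=0$. -/

import Mathlib

open scoped TensorProduct

noncomputable section

section General

open Coalgebra WithConv

variable {𝕜 H : Type*} [Field 𝕜] [Ring H] [Bialgebra 𝕜 H]

/-- The leg notation `f₁₂ = f ⊗ ε`. -/
def leg12 (f : H ⊗[𝕜] H →ₗ[𝕜] 𝕜) : H ⊗[𝕜] (H ⊗[𝕜] H) →ₗ[𝕜] 𝕜 :=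
  LinearMap.mul' 𝕜 𝕜 ∘ₗ TensorProduct.map f counit ∘ₗ (TensorProduct.assoc 𝕜 H H H).symm.toLinearMap

/-- The leg notation `f₂₃ = ε ⊗ f`. -/
def leg23 (f : H ⊗[𝕜] H →ₗ[𝕜] 𝕜) : H ⊗[𝕜] (H ⊗[𝕜] H) →ₗ[𝕜] 𝕜 :=
  LinearMap.mul' 𝕜 𝕜 ∘ₗ TensorProduct.map counit f

/-- The leg notation `f₁₃ = (ε ⊗ f)(τ ⊗ id)`. -/
def leg13 (f : H ⊗[𝕜] H →ₗ[𝕜] 𝕜) : H ⊗[𝕜] (H ⊗[𝕜] H) →ₗ[𝕜] 𝕜 :=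
  leg23 f ∘ₗ (TensorProduct.leftComm 𝕜 H H H).toLinearMap

variable (𝕜 H) in
/-- `id ⊗ m : H ⊗ H ⊗ H → H ⊗ H`. -/
def idTensorMul : H ⊗[𝕜] (H ⊗[𝕜] H) →ₗ[𝕜] H ⊗[𝕜] H :=
  (LinearMap.mul' 𝕜 H).lTensor H

variable (𝕜 H) in
/-- `m ⊗ id : H ⊗ H ⊗ H → H ⊗ H`. -/
def mulTensorId : H ⊗[𝕜] (H ⊗[𝕜] H) →ₗ[𝕜] H ⊗[𝕜] H :=
  (LinearMap.mul' 𝕜 H).rTensor H ∘ₗ (TensorProduct.assoc 𝕜 H H H).symm.toLinearMap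

variable (𝕜 H) in
/-- A universal `R`-form on the bialgebra `H`: a convolution invertible linear map
`R : H ⊗ H → 𝕜` with `R * m = mᵒᵖ * R`, `R (id ⊗ m) = R₁₃ * R₁₂` and `R (m ⊗ id) = R₁₃ * R₂₃`,
all products being convolution products. -/
structure UniversalRForm where
  /-- `R`, as an invertible element of the convolution algebra. -/
  unit : (WithConv (H ⊗[𝕜] H →ₗ[𝕜] 𝕜))ˣ
  conv_mul :
    toConv (Algebra.linearMap 𝕜 H ∘ₗ unit.val.ofConv) * toConv (LinearMap.mul' 𝕜 H) =
      toConv (LinearMap.mul' 𝕜 H ∘ₗ (TensorProduct.comm 𝕜 H H).toLinearMap) *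
        toConv (Algebra.linearMap 𝕜 H ∘ₗ unit.val.ofConv)
  comp_idTensorMul :
    toConv (unit.val.ofConv ∘ₗ idTensorMul 𝕜 H) =
      toConv (leg13 unit.val.ofConv) * toConv (leg12 unit.val.ofConv)
  comp_mulTensorId :
    toConv (unit.val.ofConv ∘ₗ mulTensorId 𝕜 H) =
      toConv (leg13 unit.val.ofConv) * toConv (leg23 unit.val.ofConv)

/-- The linear map `R : H ⊗ H → 𝕜`. -/
def UniversalRForm.form (R : UniversalRForm 𝕜 H) : H ⊗[𝕜] H →ₗ[𝕜] 𝕜 := R.unit.val.ofConv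

/-- The convolution inverse `R⁻¹ : H ⊗ H → 𝕜`. -/
def UniversalRForm.invForm (R : UniversalRForm 𝕜 H) : H ⊗[𝕜] H →ₗ[𝕜] 𝕜 := R.unit.inv.ofConv

/-- `χ` is an infinitesimal `R`-form on the coquasitriangular bialgebra `(H, R)`:
`(uχ) * m = m * (uχ)`, `χ (id ⊗ m) = χ₁₂ + R⁻¹₁₂ * χ₁₃ * R₁₂` and
`χ (m ⊗ id) = χ₂₃ + R⁻¹₂₃ * χ₁₃ * R₂₃`, all products being convolution products. -/
structure IsInfinitesimalRForm (R : UniversalRForm 𝕜 H) (χ : H ⊗[𝕜] H →ₗ[𝕜] 𝕜) : Prop where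
  conv_mul :
    toConv (Algebra.linearMap 𝕜 H ∘ₗ χ) * toConv (LinearMap.mul' 𝕜 H) =
      toConv (LinearMap.mul' 𝕜 H) * toConv (Algebra.linearMap 𝕜 H ∘ₗ χ)
  comp_idTensorMul :
    toConv (χ ∘ₗ idTensorMul 𝕜 H) =
      toConv (leg12 χ) + toConv (leg12 R.invForm) * toConv (leg13 χ) * toConv (leg12 R.form)
  comp_mulTensorId :
    toConv (χ ∘ₗ mulTensorId 𝕜 H) =
      toConv (leg23 χ) + toConv (leg23 R.invForm) * toConv (leg13 χ) * toConv (leg23 R.form)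

/-- The linear map `a ⊗ b ↦ φ a b`. -/
def uncurryConv (φ : H →ₗ[𝕜] WithConv (H →ₗ[𝕜] 𝕜)) : H ⊗[𝕜] H →ₗ[𝕜] 𝕜 :=
  TensorProduct.lift ((WithConv.linearEquiv 𝕜 (H →ₗ[𝕜] 𝕜)).toLinearMap ∘ₗ φ)

@[simp] theorem uncurryConv_tmul (φ : H →ₗ[𝕜] WithConv (H →ₗ[𝕜] 𝕜)) (a b : H) :
    uncurryConv φ (a ⊗ₜ b) = φ a b := rfl

theorem convMul_tmul {A : Type*} [Ring A] [Algebra 𝕜 A]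
    (f g : WithConv (H ⊗[𝕜] H →ₗ[𝕜] A)) (a b : H) {ι κ : Type*} (ra : Repr 𝕜 a ι)
    (rb : Repr 𝕜 b κ) : (f * g) (a ⊗ₜ b) = ∑ i ∈ ra.index, ∑ j ∈ rb.index,
      f (ra.left i ⊗ₜ rb.left j) * g (ra.right i ⊗ₜ rb.right j) := by
  rw [LinearMap.convMul_apply, TensorProduct.comul_tmul, ← ra.eq, ← rb.eq]
  simp only [TensorProduct.sum_tmul, TensorProduct.tmul_sum, map_sum,
    TensorProduct.AlgebraTensorModule.tensorTensorTensorComm_tmul, TensorProduct.map_tmul,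
    LinearMap.mul'_apply]
  exact Finset.sum_comm

theorem convMul_uncurryConv (φ ψ : H →ₗ[𝕜] WithConv (H →ₗ[𝕜] 𝕜)) (a b : H) :
    (toConv (uncurryConv φ) * toConv (uncurryConv ψ)) (a ⊗ₜ b) =
      (LinearMap.mul' 𝕜 (WithConv (H →ₗ[𝕜] 𝕜)) (TensorProduct.map φ ψ (comul a))) b := by
  rw [convMul_tmul _ _ a b (ℛ 𝕜 a) (ℛ 𝕜 b), ← (ℛ 𝕜 a).eq]
  simp [(ℛ 𝕜 b).convMul_apply]

@[simp] theorem leg12_tmul (f : H ⊗[𝕜] H →ₗ[𝕜] 𝕜) (a b c : H) :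
    leg12 f (a ⊗ₜ (b ⊗ₜ c)) = f (a ⊗ₜ b) * counit c := rfl

@[simp] theorem leg23_tmul (f : H ⊗[𝕜] H →ₗ[𝕜] 𝕜) (a b c : H) :
    leg23 f (a ⊗ₜ (b ⊗ₜ c)) = counit a * f (b ⊗ₜ c) := rfl

@[simp] theorem leg13_tmul (f : H ⊗[𝕜] H →ₗ[𝕜] 𝕜) (a b c : H) :
    leg13 f (a ⊗ₜ (b ⊗ₜ c)) = counit b * f (a ⊗ₜ c) := rfl

theorem convMul_tmul_tmul (f g : WithConv (H ⊗[𝕜] (H ⊗[𝕜] H) →ₗ[𝕜] 𝕜)) (a b c : H) :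
    (f * g) (a ⊗ₜ (b ⊗ₜ c)) =
      ∑ i ∈ (ℛ 𝕜 a).index, ∑ j ∈ (ℛ 𝕜 b).index, ∑ k ∈ (ℛ 𝕜 c).index,
        f ((ℛ 𝕜 a).left i ⊗ₜ ((ℛ 𝕜 b).left j ⊗ₜ (ℛ 𝕜 c).left k)) *
          g ((ℛ 𝕜 a).right i ⊗ₜ ((ℛ 𝕜 b).right j ⊗ₜ (ℛ 𝕜 c).right k)) := by
  rw [LinearMap.convMul_apply, TensorProduct.comul_tmul, TensorProduct.comul_tmul]
  conv_lhs => rw [← (ℛ 𝕜 a).eq, ← (ℛ 𝕜 b).eq, ← (ℛ 𝕜 c).eq]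
  simp only [TensorProduct.sum_tmul, TensorProduct.tmul_sum, map_sum,
    TensorProduct.AlgebraTensorModule.tensorTensorTensorComm_tmul, TensorProduct.map_tmul,
    LinearMap.mul'_apply]
  rw [Finset.sum_comm]
  conv_lhs => enter [2, x]; rw [Finset.sum_comm]
  rw [Finset.sum_comm]

theorem sum_counit_left (f : H →ₗ[𝕜] 𝕜) (a : H) :
    ∑ i ∈ (ℛ 𝕜 a).index, counit ((ℛ 𝕜 a).left i) * f ((ℛ 𝕜 a).right i) = f a := by
  conv_rhs => rw [← sum_counit_smul (ℛ 𝕜 a)]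
  simp

theorem sum_counit_right (f : H →ₗ[𝕜] 𝕜) (a : H) :
    ∑ i ∈ (ℛ 𝕜 a).index, f ((ℛ 𝕜 a).left i) * counit ((ℛ 𝕜 a).right i) = f a := by
  have h := congrArg (TensorProduct.lift ((LinearMap.mul 𝕜 𝕜) ∘ₗ f))
    (sum_tmul_counit_eq (R := 𝕜) (ℛ 𝕜 a))
  simpa only [map_sum, TensorProduct.lift.tmul, LinearMap.comp_apply, LinearMap.mul_apply',
    mul_one] using h

theorem leg13_convMul_leg23 (f g : H ⊗[𝕜] H →ₗ[𝕜] 𝕜) (a b c : H) :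
    (toConv (leg13 f) * toConv (leg23 g)) (a ⊗ₜ (b ⊗ₜ c)) =
      ∑ k ∈ (ℛ 𝕜 c).index, f (a ⊗ₜ (ℛ 𝕜 c).left k) * g (b ⊗ₜ (ℛ 𝕜 c).right k) := by
  rw [convMul_tmul_tmul]
  refine ((Finset.sum_congr rfl fun i _ => Finset.sum_comm).trans Finset.sum_comm).trans ?_
  refine Finset.sum_congr rfl fun k _ => ?_
  have ha := sum_counit_right (f ∘ₗ (TensorProduct.mk 𝕜 H H).flip ((ℛ 𝕜 c).left k)) a
  have hb := sum_counit_left (g ∘ₗ (TensorProduct.mk 𝕜 H H).flip ((ℛ 𝕜 c).right k)) b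
  simp only [LinearMap.comp_apply, LinearMap.flip_apply, TensorProduct.mk_apply] at ha hb
  rw [← ha, ← hb, Finset.sum_mul_sum]
  refine Finset.sum_congr rfl fun i _ => Finset.sum_congr rfl fun j _ => ?_
  simp only [leg13_tmul, leg23_tmul]
  ring

theorem leg13_convMul_leg12 (f g : H ⊗[𝕜] H →ₗ[𝕜] 𝕜) (a b c : H) :
    (toConv (leg13 f) * toConv (leg12 g)) (a ⊗ₜ (b ⊗ₜ c)) =
      ∑ i ∈ (ℛ 𝕜 a).index, f ((ℛ 𝕜 a).left i ⊗ₜ c) * g ((ℛ 𝕜 a).right i ⊗ₜ b) := by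
  rw [convMul_tmul_tmul]
  refine Finset.sum_congr rfl fun i _ => ?_
  have hc := sum_counit_right (f ∘ₗ TensorProduct.mk 𝕜 H H ((ℛ 𝕜 a).left i)) c
  have hb := sum_counit_left (g ∘ₗ TensorProduct.mk 𝕜 H H ((ℛ 𝕜 a).right i)) b
  simp only [LinearMap.comp_apply, TensorProduct.mk_apply] at hb hc
  rw [← hb, ← hc, Finset.sum_mul_sum, Finset.sum_comm]
  refine Finset.sum_congr rfl fun k _ => Finset.sum_congr rfl fun j _ => ?_
  simp only [leg13_tmul, leg12_tmul]
  ring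

end General

/-- The defining relations of `SL_q(2)` on the free generators `α, β, γ, δ`, which are indexed by
`(0, 0), (0, 1), (1, 0), (1, 1)`: the Manin relations `βα = qαβ`, `γα = qαγ`, `δβ = qβδ`,
`δγ = qγδ`, `γβ = βγ`, `αδ - δα = (q⁻¹ - q)βγ` and the relation `αδ - q⁻¹βγ = 1`. -/
inductive SLq2.Rel {𝕜 : Type*} [Field 𝕜] (q : 𝕜ˣ) :
    FreeAlgebra 𝕜 (Fin 2 × Fin 2) → FreeAlgebra 𝕜 (Fin 2 × Fin 2) → Prop
  | ba : Rel q (FreeAlgebra.ι 𝕜 (0, 1) * FreeAlgebra.ι 𝕜 (0, 0))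
      ((q : 𝕜) • (FreeAlgebra.ι 𝕜 (0, 0) * FreeAlgebra.ι 𝕜 (0, 1)))
  | ca : Rel q (FreeAlgebra.ι 𝕜 (1, 0) * FreeAlgebra.ι 𝕜 (0, 0))
      ((q : 𝕜) • (FreeAlgebra.ι 𝕜 (0, 0) * FreeAlgebra.ι 𝕜 (1, 0)))
  | db : Rel q (FreeAlgebra.ι 𝕜 (1, 1) * FreeAlgebra.ι 𝕜 (0, 1))
      ((q : 𝕜) • (FreeAlgebra.ι 𝕜 (0, 1) * FreeAlgebra.ι 𝕜 (1, 1)))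
  | dc : Rel q (FreeAlgebra.ι 𝕜 (1, 1) * FreeAlgebra.ι 𝕜 (1, 0))
      ((q : 𝕜) • (FreeAlgebra.ι 𝕜 (1, 0) * FreeAlgebra.ι 𝕜 (1, 1)))
  | cb : Rel q (FreeAlgebra.ι 𝕜 (1, 0) * FreeAlgebra.ι 𝕜 (0, 1))
      (FreeAlgebra.ι 𝕜 (0, 1) * FreeAlgebra.ι 𝕜 (1, 0))
  | ad : Rel q
      (FreeAlgebra.ι 𝕜 (0, 0) * FreeAlgebra.ι 𝕜 (1, 1)
        - FreeAlgebra.ι 𝕜 (1, 1) * FreeAlgebra.ι 𝕜 (0, 0))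
      (((q : 𝕜)⁻¹ - (q : 𝕜)) • (FreeAlgebra.ι 𝕜 (0, 1) * FreeAlgebra.ι 𝕜 (1, 0)))
  | det : Rel q
      (FreeAlgebra.ι 𝕜 (0, 0) * FreeAlgebra.ι 𝕜 (1, 1)
        - (q : 𝕜)⁻¹ • (FreeAlgebra.ι 𝕜 (0, 1) * FreeAlgebra.ι 𝕜 (1, 0))) 1

/-- The algebra `SL_q(2)`. -/
def SLq2 {𝕜 : Type*} [Field 𝕜] (q : 𝕜ˣ) : Type _ := RingQuot (SLq2.Rel q)

namespace SLq2

variable {𝕜 : Type*} [Field 𝕜]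

instance (q : 𝕜ˣ) : Ring (SLq2 q) := inferInstanceAs (Ring (RingQuot (SLq2.Rel q)))

instance (q : 𝕜ˣ) : Algebra 𝕜 (SLq2 q) := inferInstanceAs (Algebra 𝕜 (RingQuot (SLq2.Rel q)))

/-- The quotient map from the free algebra. -/
def mk (q : 𝕜ˣ) : FreeAlgebra 𝕜 (Fin 2 × Fin 2) →ₐ[𝕜] SLq2 q := RingQuot.mkAlgHom 𝕜 (SLq2.Rel q)

/-- The generators, `T 0 0 = α`, `T 0 1 = β`, `T 1 0 = γ`, `T 1 1 = δ`. -/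
def T (q : 𝕜ˣ) (i j : Fin 2) : SLq2 q := mk q (FreeAlgebra.ι 𝕜 (i, j))

/-- Four elements `M 0 0, M 0 1, M 1 0, M 1 1` of an algebra satisfying the relations of `SL_q(2)`. -/
structure Relations (q : 𝕜ˣ) {A : Type*} [Ring A] [Algebra 𝕜 A] (M : Fin 2 → Fin 2 → A) :
    Prop where
  ba : M 0 1 * M 0 0 = (q : 𝕜) • (M 0 0 * M 0 1)
  ca : M 1 0 * M 0 0 = (q : 𝕜) • (M 0 0 * M 1 0)
  db : M 1 1 * M 0 1 = (q : 𝕜) • (M 0 1 * M 1 1)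
  dc : M 1 1 * M 1 0 = (q : 𝕜) • (M 1 0 * M 1 1)
  cb : M 1 0 * M 0 1 = M 0 1 * M 1 0
  ad : M 0 0 * M 1 1 - M 1 1 * M 0 0 = ((q : 𝕜)⁻¹ - (q : 𝕜)) • (M 0 1 * M 1 0)
  det : M 0 0 * M 1 1 - (q : 𝕜)⁻¹ • (M 0 1 * M 1 0) = 1

theorem mk_rel {q : 𝕜ˣ} {x y : FreeAlgebra 𝕜 (Fin 2 × Fin 2)} (h : Rel q x y) :
    mk q x = mk q y :=
  RingQuot.mkAlgHom_rel 𝕜 h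

theorem relations_T (q : 𝕜ˣ) : Relations q (T q) where
  ba := by simpa only [T, map_mul, map_smul] using mk_rel (Rel.ba (q := q))
  ca := by simpa only [T, map_mul, map_smul] using mk_rel (Rel.ca (q := q))
  db := by simpa only [T, map_mul, map_smul] using mk_rel (Rel.db (q := q))
  dc := by simpa only [T, map_mul, map_smul] using mk_rel (Rel.dc (q := q))
  cb := by simpa only [T, map_mul] using mk_rel (Rel.cb (q := q))
  ad := by simpa only [T, map_mul, map_sub, map_smul] using mk_rel (Rel.ad (q := q))
  det := by simpa only [T, map_mul, map_sub, map_smul, map_one] using mk_rel (Rel.det (q := q))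

/-- The universal property of `SL_q(2)`. -/
def lift {q : 𝕜ˣ} {A : Type*} [Ring A] [Algebra 𝕜 A] (M : Fin 2 → Fin 2 → A)
    (h : Relations q M) : SLq2 q →ₐ[𝕜] A :=
  RingQuot.liftAlgHom 𝕜 ⟨FreeAlgebra.lift 𝕜 fun p => M p.1 p.2, by
    rintro _ _ (_ | _ | _ | _ | _ | _ | _)
    · simpa using h.ba
    · simpa using h.ca
    · simpa using h.db
    · simpa using h.dc
    · simpa using h.cb
    · simpa only [map_mul, map_sub, map_smul, FreeAlgebra.lift_ι_apply] using h.ad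
    · simpa only [map_mul, map_sub, map_smul, map_one, FreeAlgebra.lift_ι_apply] using h.det⟩

@[simp] theorem lift_T {q : 𝕜ˣ} {A : Type*} [Ring A] [Algebra 𝕜 A] (M : Fin 2 → Fin 2 → A)
    (h : Relations q M) (i j : Fin 2) : lift M h (T q i j) = M i j := by
  exact (RingQuot.liftAlgHom_mkAlgHom_apply 𝕜 _ _ _).trans (FreeAlgebra.lift_ι_apply _ _)

theorem hom_ext {q : 𝕜ˣ} {A : Type*} [Ring A] [Algebra 𝕜 A] {f g : SLq2 q →ₐ[𝕜] A}
    (h : ∀ i j, f (T q i j) = g (T q i j)) : f = g := by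
  apply RingQuot.ringQuot_ext'
  apply FreeAlgebra.hom_ext
  funext p
  exact h p.1 p.2

theorem induction {q : 𝕜ˣ} {P : SLq2 q → Prop} (hs : ∀ r : 𝕜, P (algebraMap 𝕜 _ r))
    (hT : ∀ i j, P (T q i j)) (hm : ∀ x y, P x → P y → P (x * y))
    (ha : ∀ x y, P x → P y → P (x + y)) (x : SLq2 q) : P x := by
  obtain ⟨x, rfl⟩ := RingQuot.mkAlgHom_surjective 𝕜 (Rel q) x
  induction x using FreeAlgebra.induction with
  | grade0 r => rw [AlgHom.commutes]; exact hs r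
  | grade1 p => exact hT p.1 p.2
  | mul a b iha ihb => rw [map_mul]; exact hm _ _ iha ihb
  | add a b iha ihb => rw [map_add]; exact ha _ _ iha ihb

theorem T_ba (q : 𝕜ˣ) : T q 0 1 * T q 0 0 = (q : 𝕜) • (T q 0 0 * T q 0 1) := (relations_T q).ba
theorem T_ca (q : 𝕜ˣ) : T q 1 0 * T q 0 0 = (q : 𝕜) • (T q 0 0 * T q 1 0) := (relations_T q).ca
theorem T_db (q : 𝕜ˣ) : T q 1 1 * T q 0 1 = (q : 𝕜) • (T q 0 1 * T q 1 1) := (relations_T q).db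
theorem T_dc (q : 𝕜ˣ) : T q 1 1 * T q 1 0 = (q : 𝕜) • (T q 1 0 * T q 1 1) := (relations_T q).dc
theorem T_cb (q : 𝕜ˣ) : T q 1 0 * T q 0 1 = T q 0 1 * T q 1 0 := (relations_T q).cb
theorem T_ad (q : 𝕜ˣ) : T q 0 0 * T q 1 1 = 1 + (q : 𝕜)⁻¹ • (T q 0 1 * T q 1 0) := by
  rw [← (relations_T q).det]; abel
theorem T_da (q : 𝕜ˣ) : T q 1 1 * T q 0 0 = 1 + (q : 𝕜) • (T q 0 1 * T q 1 0) := by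
  have h1 := (relations_T q).ad
  rw [T_ad, sub_smul] at h1
  rw [sub_eq_iff_eq_add] at h1
  have h2 : T q 1 1 * T q 0 0 = 1 + (q : 𝕜)⁻¹ • (T q 0 1 * T q 1 0)
      - ((q : 𝕜)⁻¹ • (T q 0 1 * T q 1 0) - (q : 𝕜) • (T q 0 1 * T q 1 0)) := by
    rw [h1]; abel
  rw [h2]; abel

theorem relations_comul (q : 𝕜ˣ) :
    Relations q fun i j => ∑ k, T q i k ⊗ₜ[𝕜] T q k j := by
  have hq : (q : 𝕜) ≠ 0 := q.ne_zero
  constructor <;>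
  simp only [Fin.sum_univ_two, add_mul, mul_add, Algebra.TensorProduct.tmul_mul_tmul, T_ba, T_ca,
    T_db, T_dc, T_cb, T_ad, T_da, TensorProduct.tmul_smul, ← TensorProduct.smul_tmul', TensorProduct.add_tmul, TensorProduct.tmul_add, smul_add, smul_smul, Algebra.TensorProduct.one_def] <;>
  match_scalars <;> field_simp <;> ring

/-- The comultiplication. -/
def comulHom (q : 𝕜ˣ) : SLq2 q →ₐ[𝕜] SLq2 q ⊗[𝕜] SLq2 q := lift _ (relations_comul q)

theorem relations_counit (q : 𝕜ˣ) :
    Relations q fun i j => if i = j then (1 : 𝕜) else 0 := by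
  constructor <;> simp

/-- The counit. -/
def counitHom (q : 𝕜ˣ) : SLq2 q →ₐ[𝕜] 𝕜 := lift _ (relations_counit q)

instance (q : 𝕜ˣ) : Bialgebra 𝕜 (SLq2 q) :=
  Bialgebra.ofAlgHom (comulHom q) (counitHom q)
    (hom_ext fun i j => by
      simp [comulHom, TensorProduct.tmul_add, TensorProduct.add_tmul]; abel)
    (hom_ext fun i j => by
      fin_cases i <;> fin_cases j <;> simp [comulHom, counitHom])
    (hom_ext fun i j => by
      fin_cases i <;> fin_cases j <;> simp [comulHom, counitHom])

theorem comul_T (q : 𝕜ˣ) (i j : Fin 2) :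
    Coalgebra.comul (R := 𝕜) (T q i j) = ∑ k, T q i k ⊗ₜ[𝕜] T q k j :=
  lift_T _ (relations_comul q) i j

theorem counit_T (q : 𝕜ˣ) (i j : Fin 2) :
    Coalgebra.counit (R := 𝕜) (T q i j) = if i = j then 1 else 0 :=
  lift_T _ (relations_counit q) i j


theorem relations_antipode (q : 𝕜ˣ) :
    Relations q (A := (SLq2 q)ᵐᵒᵖ) ![![.op (T q 1 1), .op (-(q : 𝕜) • T q 0 1)],
      ![.op (-(q : 𝕜)⁻¹ • T q 1 0), .op (T q 0 0)]] := by
  have hq : (q : 𝕜) ≠ 0 := q.ne_zero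
  constructor <;> apply MulOpposite.unop_injective <;>
  simp [T_ba, T_ca, T_db, T_dc, T_cb, T_ad, T_da, smul_smul] <;>
  match_scalars <;> field_simp

/-- The antipode, as an anti-homomorphism: `α ↦ δ`, `β ↦ -qβ`, `γ ↦ -q⁻¹γ`, `δ ↦ α`. -/
def antipodeHom (q : 𝕜ˣ) : SLq2 q →ₐ[𝕜] (SLq2 q)ᵐᵒᵖ := lift _ (relations_antipode q)

/-- The antipode as a linear map. -/
def S (q : 𝕜ˣ) : SLq2 q →ₗ[𝕜] SLq2 q :=
  (MulOpposite.opLinearEquiv 𝕜).symm.toLinearMap ∘ₗ (antipodeHom q).toLinearMap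

theorem S_mul (q : 𝕜ˣ) (x y : SLq2 q) : S q (x * y) = S q y * S q x := by
  simp [S]

theorem S_one (q : 𝕜ˣ) : S q 1 = 1 := by simp [S]

theorem S_T (q : 𝕜ˣ) (i j : Fin 2) : S q (T q i j) =
    ![![T q 1 1, -(q : 𝕜) • T q 0 1], ![-(q : 𝕜)⁻¹ • T q 1 0, T q 0 0]] i j := by
  fin_cases i <;> fin_cases j <;> simp [S, antipodeHom]

open Coalgebra WithConv

theorem mul_S (q : 𝕜ˣ) (x : SLq2 q) :
    LinearMap.mul' 𝕜 _ ((S q).lTensor _ (comul x)) = algebraMap 𝕜 _ (counit x) := by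
  have hq : (q : 𝕜) ≠ 0 := q.ne_zero
  induction x using SLq2.induction with
  | hs r => simp [S_one, Algebra.TensorProduct.algebraMap_apply]
  | hT i j =>
    rw [comul_T, counit_T]
    fin_cases i <;> fin_cases j <;>
    simp [S_T, T_ba, T_ca, T_db, T_dc, T_cb, T_ad, T_da, smul_smul, hq]
  | hm x y hx hy =>
    rw [← (ℛ 𝕜 x).eq] at hx
    rw [← (ℛ 𝕜 y).eq] at hy
    simp only [map_sum, LinearMap.lTensor_tmul, LinearMap.mul'_apply] at hx hy
    rw [Bialgebra.comul_mul, ← (ℛ 𝕜 x).eq, ← (ℛ 𝕜 y).eq, Bialgebra.counit_mul, map_mul (algebraMap 𝕜 (SLq2 q)), ← hx]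
    simp only [Finset.sum_mul_sum, Algebra.TensorProduct.tmul_mul_tmul]
    simp only [Finset.sum_mul, map_sum, LinearMap.lTensor_tmul, LinearMap.mul'_apply, S_mul]
    refine Finset.sum_congr rfl fun i _ => ?_
    rw [mul_assoc, ← Algebra.commutes, ← hy]
    simp only [Finset.sum_mul, Finset.mul_sum, mul_assoc]
  | ha x y hx hy => simp only [map_add, hx, hy]

theorem S_mul' (q : 𝕜ˣ) (x : SLq2 q) :
    LinearMap.mul' 𝕜 _ ((S q).rTensor _ (comul x)) = algebraMap 𝕜 _ (counit x) := by
  have hq : (q : 𝕜) ≠ 0 := q.ne_zero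
  induction x using SLq2.induction with
  | hs r => simp [Algebra.algebraMap_eq_smul_one, S_one, Algebra.TensorProduct.one_def]
  | hT i j =>
    rw [comul_T, counit_T]
    fin_cases i <;> fin_cases j <;>
    simp [S_T, T_ba, T_ca, T_db, T_dc, T_cb, T_ad, T_da, smul_smul, hq]
  | hm x y hx hy =>
    rw [← (ℛ 𝕜 x).eq] at hx
    rw [← (ℛ 𝕜 y).eq] at hy
    simp only [map_sum, LinearMap.rTensor_tmul, LinearMap.mul'_apply] at hx hy
    rw [Bialgebra.comul_mul, ← (ℛ 𝕜 x).eq, ← (ℛ 𝕜 y).eq, Bialgebra.counit_mul,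
      map_mul (algebraMap 𝕜 (SLq2 q)), Algebra.commutes, ← hy]
    simp only [Finset.sum_mul_sum, Algebra.TensorProduct.tmul_mul_tmul]
    simp only [Finset.sum_mul, map_sum, LinearMap.rTensor_tmul, LinearMap.mul'_apply, S_mul]
    rw [Finset.sum_comm]
    refine Finset.sum_congr rfl fun i _ => ?_
    rw [mul_assoc, ← Algebra.commutes, ← hx]
    simp only [Finset.sum_mul, Finset.mul_sum, mul_assoc]
  | ha x y hx hy => simp only [map_add, hx, hy]

/-- The values `R (T i j ⊗ T k l)` on generators, where `s` is a square root of `q`: they are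
`s⁻¹ q` on `α ⊗ α` and `δ ⊗ δ`, `s⁻¹` on `α ⊗ δ` and `δ ⊗ α`, `s⁻¹ (q - q⁻¹)` on `β ⊗ γ`, and
zero on the other pairs. -/
def rVal (q s : 𝕜ˣ) (i j k l : Fin 2) : 𝕜 :=
  (s : 𝕜)⁻¹ * if i = j ∧ k = l then (if i = k then (q : 𝕜) else 1)
    else if i = 0 ∧ j = 1 ∧ k = 1 ∧ l = 0 then (q : 𝕜) - (q : 𝕜)⁻¹ else 0

theorem relations_L {q s : 𝕜ˣ} (hs : s ^ 2 = q) :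
    Relations q (A := (Matrix (Fin 2) (Fin 2) 𝕜)ᵐᵒᵖ)
      fun k l => .op (Matrix.of fun i j => rVal q s i j k l) := by
  have hs0 : (s : 𝕜) ≠ 0 := s.ne_zero
  subst hs
  constructor <;> apply MulOpposite.unop_injective <;> ext i j <;>
  fin_cases i <;> fin_cases j <;>
  simp [rVal, Matrix.mul_apply] <;> field_simp <;> ring

/-- The anti-homomorphism `b ↦ (R (T i j ⊗ b))ᵢⱼ` to `2 × 2` matrices. -/
def L {q s : 𝕜ˣ} (hs : s ^ 2 = q) : SLq2 q →ₐ[𝕜] (Matrix (Fin 2) (Fin 2) 𝕜)ᵐᵒᵖ :=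
  lift _ (relations_L hs)

/-- The linear form `b ↦ R (T i j ⊗ b)`. -/
def ell {q s : 𝕜ˣ} (hs : s ^ 2 = q) (i j : Fin 2) : SLq2 q →ₗ[𝕜] 𝕜 where
  toFun b := (L hs b).unop i j
  map_add' := by simp
  map_smul' := by simp

theorem ell_T {q s : 𝕜ˣ} (hs : s ^ 2 = q) (i j k l : Fin 2) :
    ell hs i j (T q k l) = rVal q s i j k l := by
  simp [ell, L]

theorem ell_mul {q s : 𝕜ˣ} (hs : s ^ 2 = q) (i j : Fin 2) (b c : SLq2 q) :
    ell hs i j (b * c) = ∑ k, ell hs i k c * ell hs k j b := by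
  simp [ell, Matrix.mul_apply]

theorem ell_algebraMap {q s : 𝕜ˣ} (hs : s ^ 2 = q) (i j : Fin 2) (r : 𝕜) :
    ell hs i j (algebraMap 𝕜 _ r) = if i = j then r else 0 := by
  simp [ell, Matrix.algebraMap_matrix_apply]

theorem ell_one {q s : 𝕜ˣ} (hs : s ^ 2 = q) (i j : Fin 2) :
    ell hs i j 1 = if i = j then 1 else 0 := by
  simp [ell, Matrix.one_apply]

theorem ellell_mul {q s : 𝕜ˣ} (hs : s ^ 2 = q) (i j k l : Fin 2) (b c : SLq2 q) :
    (toConv (ell hs i j) * toConv (ell hs k l)) (b * c) =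
      ∑ m, ∑ n, (toConv (ell hs i m) * toConv (ell hs k n)) c *
        (toConv (ell hs m j) * toConv (ell hs n l)) b := by
  simp only [LinearMap.convMul_apply, Bialgebra.comul_mul]
  rw [← (ℛ 𝕜 b).eq, ← (ℛ 𝕜 c).eq]
  simp only [Finset.sum_mul_sum, map_sum, Algebra.TensorProduct.tmul_mul_tmul,
    TensorProduct.map_tmul, LinearMap.mul'_apply, ell_mul, Fin.sum_univ_two,
    ← Finset.sum_add_distrib]
  rw [Finset.sum_comm]
  refine Finset.sum_congr rfl fun _ _ => Finset.sum_congr rfl fun _ _ => ?_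
  ring

theorem ellell_T {q s : 𝕜ˣ} (hs : s ^ 2 = q) (i j k l m n : Fin 2) :
    (toConv (ell hs i j) * toConv (ell hs k l)) (T q m n) =
      ∑ p, rVal q s i j m p * rVal q s k l p n := by
  simp [LinearMap.convMul_apply, comul_T, ell_T]

theorem ellell_algebraMap {q s : 𝕜ˣ} (hs : s ^ 2 = q) (i j k l : Fin 2) (r : 𝕜) :
    (toConv (ell hs i j) * toConv (ell hs k l)) (algebraMap 𝕜 _ r) =
      if i = j ∧ k = l then r else 0 := by
  rw [ite_and, LinearMap.convMul_apply, Bialgebra.comul_algebraMap]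
  simp [Algebra.TensorProduct.algebraMap_apply, ell_algebraMap, ell_one]
  split_ifs <;> rfl

/-- The invariant vector of `V ⊗ V`. -/
def qvec (q : 𝕜ˣ) (i k : Fin 2) : 𝕜 :=
  if i = 0 ∧ k = 1 then 1 else if i = 1 ∧ k = 0 then -(q : 𝕜)⁻¹ else 0

theorem ellell_right {q s : 𝕜ˣ} (hs : s ^ 2 = q) (b : SLq2 q) : ∀ i k : Fin 2,
    (toConv (ell hs i 0) * toConv (ell hs k 1)) b
      - (q : 𝕜)⁻¹ * (toConv (ell hs i 1) * toConv (ell hs k 0)) b = counit b * qvec q i k := by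
  induction b using SLq2.induction with
  | hs r =>
    intro i k
    rw [ellell_algebraMap, ellell_algebraMap]
    fin_cases i <;> fin_cases k <;> simp [qvec, mul_comm]
  | hT m n =>
    intro i k
    have hs0 : (s : 𝕜) ≠ 0 := s.ne_zero
    rw [ellell_T, ellell_T, counit_T]
    subst hs
    fin_cases i <;> fin_cases k <;> fin_cases m <;> fin_cases n <;>
    simp [rVal, qvec] <;> field_simp <;> ring
  | hm x y hx hy =>
    intro i k
    rw [ellell_mul, ellell_mul, Bialgebra.counit_mul]
    simp only [Fin.sum_univ_two]
    have h00 := hx 0 0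
    have h01 := hx 0 1
    have h10 := hx 1 0
    have h11 := hx 1 1
    have hy := hy i k
    simp only [qvec, one_ne_zero, zero_ne_one, and_false, and_true, and_self, if_true, if_false, 
      mul_zero, mul_one] at h00 h01 h10 h11
    linear_combination (toConv (ell hs i 0) * toConv (ell hs k 0)) y * h00 +
      (toConv (ell hs i 0) * toConv (ell hs k 1)) y * h01 +
      (toConv (ell hs i 1) * toConv (ell hs k 0)) y * h10 +
      (toConv (ell hs i 1) * toConv (ell hs k 1)) y * h11 + counit x * hy
  | ha x y hx hy =>
    intro i k
    simp only [map_add]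
    linear_combination hx i k + hy i k

theorem ellell_left {q s : 𝕜ˣ} (hs : s ^ 2 = q) (b : SLq2 q) : ∀ j l : Fin 2,
    (toConv (ell hs 0 j) * toConv (ell hs 1 l)) b
      - (q : 𝕜)⁻¹ * (toConv (ell hs 1 j) * toConv (ell hs 0 l)) b = counit b * qvec q j l := by
  induction b using SLq2.induction with
  | hs r =>
    intro i k
    rw [ellell_algebraMap, ellell_algebraMap]
    fin_cases i <;> fin_cases k <;> simp [qvec, mul_comm]
  | hT m n =>
    intro i k
    have hs0 : (s : 𝕜) ≠ 0 := s.ne_zero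
    rw [ellell_T, ellell_T, counit_T]
    subst hs
    fin_cases i <;> fin_cases k <;> fin_cases m <;> fin_cases n <;>
    simp [rVal, qvec] <;> field_simp <;> ring
  | hm x y hx hy =>
    intro i k
    rw [ellell_mul, ellell_mul, Bialgebra.counit_mul]
    simp only [Fin.sum_univ_two]
    have h00 := hy 0 0
    have h01 := hy 0 1
    have h10 := hy 1 0
    have h11 := hy 1 1
    have hx := hx i k
    simp only [qvec, one_ne_zero, zero_ne_one, and_false, and_true, and_self, if_true, if_false, 
      mul_zero, mul_one] at h00 h01 h10 h11
    linear_combination (toConv (ell hs 0 i) * toConv (ell hs 0 k)) x * h00 +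
      (toConv (ell hs 0 i) * toConv (ell hs 1 k)) x * h01 +
      (toConv (ell hs 1 i) * toConv (ell hs 0 k)) x * h10 +
      (toConv (ell hs 1 i) * toConv (ell hs 1 k)) x * h11 + counit y * hx
  | ha x y hx hy =>
    intro i k
    simp only [map_add]
    linear_combination hx i k + hy i k

theorem relations_r {q s : 𝕜ˣ} (hs : s ^ 2 = q) :
    Relations q (A := WithConv (SLq2 q →ₗ[𝕜] 𝕜)) fun i j => toConv (ell hs i j) := by
  have hq : (q : 𝕜) ≠ 0 := q.ne_zero
  have hR := fun b i k => ellell_right hs b i k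
  have hL := fun b i k => ellell_left hs b i k
  have q00 : qvec q 0 0 = 0 := by simp [qvec]
  have q01 : qvec q 0 1 = 1 := by simp [qvec]
  have q10 : qvec q 1 0 = -(q : 𝕜)⁻¹ := by simp [qvec]
  have q11 : qvec q 1 1 = 0 := by simp [qvec]
  set N : Fin 2 → Fin 2 → Fin 2 → Fin 2 → SLq2 q → 𝕜 :=
    fun i j k l b => (toConv (ell hs i j) * toConv (ell hs k l)) b with hN
  have hcb : ∀ b, N 1 0 0 1 b = N 0 1 1 0 b := fun b => by
    have h1 := hR b 0 1
    have h2 := hL b 0 1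
    rw [q01] at h1 h2
    have h3 : (q : 𝕜)⁻¹ * (N 1 0 0 1 b - N 0 1 1 0 b) = 0 := by linear_combination h1 - h2
    simpa [hq, sub_eq_zero] using h3
  constructor <;> refine WithConv.ext (LinearMap.ext fun b => ?_)
  · change N 0 1 0 0 b = q * N 0 0 0 1 b
    have h : N 0 0 0 1 b - (q : 𝕜)⁻¹ * N 0 1 0 0 b = counit b * qvec q 0 0 := hR b 0 0
    rw [q00] at h
    field_simp at h
    linear_combination -h
  · change N 1 0 0 0 b = q * N 0 0 1 0 b
    have h : N 0 0 1 0 b - (q : 𝕜)⁻¹ * N 1 0 0 0 b = counit b * qvec q 0 0 := hL b 0 0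
    rw [q00] at h
    field_simp at h
    linear_combination -h
  · change N 1 1 0 1 b = q * N 0 1 1 1 b
    have h : N 0 1 1 1 b - (q : 𝕜)⁻¹ * N 1 1 0 1 b = counit b * qvec q 1 1 := hL b 1 1
    rw [q11] at h
    field_simp at h
    linear_combination -h
  · change N 1 1 1 0 b = q * N 1 0 1 1 b
    have h : N 1 0 1 1 b - (q : 𝕜)⁻¹ * N 1 1 1 0 b = counit b * qvec q 1 1 := hR b 1 1
    rw [q11] at h
    field_simp at h
    linear_combination -h
  · exact hcb b
  · change N 0 0 1 1 b - N 1 1 0 0 b = ((q : 𝕜)⁻¹ - q) * N 0 1 1 0 b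
    have h1 : N 0 0 1 1 b - (q : 𝕜)⁻¹ * N 0 1 1 0 b = counit b * qvec q 0 1 := hR b 0 1
    have h2 : N 1 0 0 1 b - (q : 𝕜)⁻¹ * N 1 1 0 0 b = counit b * qvec q 1 0 := hR b 1 0
    rw [q01] at h1
    rw [q10, hcb] at h2
    have h3 : (q : 𝕜) * (q : 𝕜)⁻¹ = 1 := mul_inv_cancel₀ hq
    linear_combination h1 + q * h2 - (counit b - N 1 1 0 0 b) * h3
  · change N 0 0 1 1 b - (q : 𝕜)⁻¹ * N 0 1 1 0 b = counit b
    have h1 : N 0 0 1 1 b - (q : 𝕜)⁻¹ * N 0 1 1 0 b = counit b * qvec q 0 1 := hR b 0 1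
    rw [h1, q01, mul_one]

/-- The algebra map `a ↦ R (a ⊗ -)` to the convolution algebra. -/
def r {q s : 𝕜ˣ} (hs : s ^ 2 = q) : SLq2 q →ₐ[𝕜] WithConv (SLq2 q →ₗ[𝕜] 𝕜) :=
  lift _ (relations_r hs)

@[simp] theorem r_T {q s : 𝕜ˣ} (hs : s ^ 2 = q) (i j : Fin 2) :
    r hs (T q i j) = toConv (ell hs i j) := lift_T _ _ i j

/-- The linear map `R`. -/
def rForm {q s : 𝕜ˣ} (hs : s ^ 2 = q) : SLq2 q ⊗[𝕜] SLq2 q →ₗ[𝕜] 𝕜 :=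
  uncurryConv (r hs).toLinearMap

@[simp] theorem rForm_tmul {q s : 𝕜ˣ} (hs : s ^ 2 = q) (a b : SLq2 q) :
    rForm hs (a ⊗ₜ b) = r hs a b := rfl

/-- The convolution inverse of `R`, that is `R ∘ (S ⊗ id)`. -/
def rInv {q s : 𝕜ˣ} (hs : s ^ 2 = q) : SLq2 q ⊗[𝕜] SLq2 q →ₗ[𝕜] 𝕜 :=
  uncurryConv ((r hs).toLinearMap ∘ₗ S q)

theorem rForm_mul_rInv {q s : 𝕜ˣ} (hs : s ^ 2 = q) :
    toConv (rForm hs) * toConv (rInv hs) = 1 := by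
  refine WithConv.ext (TensorProduct.ext' fun a b => ?_)
  refine (convMul_uncurryConv _ _ a b).trans ?_
  have h : LinearMap.mul' 𝕜 (WithConv (SLq2 q →ₗ[𝕜] 𝕜)) (TensorProduct.map (r hs).toLinearMap
      ((r hs).toLinearMap ∘ₗ S q) (comul a)) =
      r hs (LinearMap.mul' 𝕜 _ ((S q).lTensor _ (comul a))) := by
    rw [← (ℛ 𝕜 a).eq]
    simp
  rw [h, mul_S, AlgHom.commutes]
  simp [mul_comm]

theorem rInv_mul_rForm {q s : 𝕜ˣ} (hs : s ^ 2 = q) :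
    toConv (rInv hs) * toConv (rForm hs) = 1 := by
  refine WithConv.ext (TensorProduct.ext' fun a b => ?_)
  refine (convMul_uncurryConv _ _ a b).trans ?_
  have h : LinearMap.mul' 𝕜 (WithConv (SLq2 q →ₗ[𝕜] 𝕜)) (TensorProduct.map
      ((r hs).toLinearMap ∘ₗ S q) (r hs).toLinearMap (comul a)) =
      r hs (LinearMap.mul' 𝕜 _ ((S q).rTensor _ (comul a))) := by
    rw [← (ℛ 𝕜 a).eq]
    simp
  rw [h, S_mul', AlgHom.commutes]
  simp [mul_comm]

theorem r_mul_left {q s : 𝕜ˣ} (hs : s ^ 2 = q) (a b c : SLq2 q) :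
    r hs (a * b) c =
      ∑ k ∈ (ℛ 𝕜 c).index, r hs a ((ℛ 𝕜 c).left k) * r hs b ((ℛ 𝕜 c).right k) := by
  rw [map_mul, (ℛ 𝕜 c).convMul_apply]

theorem r_one_left {q s : 𝕜ˣ} (hs : s ^ 2 = q) (c : SLq2 q) : r hs 1 c = counit c := by
  rw [map_one]; rfl

theorem r_one_right {q s : 𝕜ˣ} (hs : s ^ 2 = q) (a : SLq2 q) : r hs a 1 = counit a := by
  induction a using SLq2.induction with
  | hs t => rw [AlgHom.commutes]; simp
  | hT i j => simp [ell_one, counit_T]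
  | hm x y hx hy => rw [map_mul]; simp [hx, hy, Algebra.TensorProduct.one_def]
  | ha x y hx hy => rw [map_add]; simp [hx, hy]

theorem r_mul_right {q s : 𝕜ˣ} (hs : s ^ 2 = q) (a : SLq2 q) : ∀ b c : SLq2 q,
    r hs a (b * c) = LinearMap.mul' 𝕜 𝕜 (TensorProduct.map
      ((rForm hs) ∘ₗ (TensorProduct.mk 𝕜 _ _).flip c)
      ((rForm hs) ∘ₗ (TensorProduct.mk 𝕜 _ _).flip b) (comul a)) := by
  induction a using SLq2.induction with
  | hs t =>
    intro b c
    rw [AlgHom.commutes, Bialgebra.comul_algebraMap, Algebra.TensorProduct.algebraMap_apply]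
    simp
    ring
  | hT i j =>
    intro b c
    rw [comul_T]
    simp [ell_mul]
  | hm x y hx hy =>
    intro b c
    rw [map_mul (r hs), LinearMap.convMul_apply, Bialgebra.comul_mul, Bialgebra.comul_mul]
    simp only [← (ℛ 𝕜 x).eq, ← (ℛ 𝕜 y).eq] at hx hy ⊢
    rw [← (ℛ 𝕜 b).eq, ← (ℛ 𝕜 c).eq]
    simp only [Finset.sum_mul_sum, Algebra.TensorProduct.tmul_mul_tmul, map_sum,
      TensorProduct.map_tmul, LinearMap.mul'_apply, hx, hy, LinearMap.comp_apply,
      LinearMap.flip_apply, TensorProduct.mk_apply, rForm_tmul, r_mul_left]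
    refine (Finset.sum_congr rfl fun j _ => Finset.sum_comm.trans
      (Finset.sum_congr rfl fun i _ => Finset.sum_comm)).trans (Finset.sum_comm.trans
      (Finset.sum_congr rfl fun i _ => Finset.sum_comm.trans
      (Finset.sum_congr rfl fun l _ => Finset.sum_comm.trans
      (Finset.sum_congr rfl fun k _ => Finset.sum_congr rfl fun j _ => ?_))))
    ring
  | ha x y hx hy =>
    intro b c
    rw [map_add, map_add, map_add, map_add, ← hx, ← hy]
    rfl

/-- `a ↦ (b ↦ R (a ⊗ b) 1)`, an algebra map to the convolution algebra of endomorphisms. -/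
def rho {q s : 𝕜ˣ} (hs : s ^ 2 = q) : SLq2 q →ₐ[𝕜] WithConv (SLq2 q →ₗ[𝕜] SLq2 q) :=
  AlgHom.ofLinearMap
    { toFun := fun a => toConv (Algebra.linearMap 𝕜 (SLq2 q) ∘ₗ (r hs a).ofConv)
      map_add' := fun a b => by rw [map_add]; ext; simp
      map_smul' := fun t a => by 
        rw [map_smul]; ext x; exact (Algebra.linearMap 𝕜 (SLq2 q)).map_smul t _ }
    (by simp; rfl)
    (fun a b => by
      simp only [LinearMap.coe_mk, AddHom.coe_mk, map_mul]
      exact congrArg toConv (LinearMap.algHom_comp_convMul_distrib (Algebra.ofId 𝕜 (SLq2 q)) _ _))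

/-- `a ↦ (b ↦ ε(b) a)`, an algebra map to the convolution algebra of endomorphisms. -/
def kappa (q : 𝕜ˣ) : SLq2 q →ₐ[𝕜] WithConv (SLq2 q →ₗ[𝕜] SLq2 q) :=
  AlgHom.ofLinearMap
    { toFun := fun a => toConv ((counit : SLq2 q →ₗ[𝕜] 𝕜).smulRight a)
      map_add' := fun a b => by ext; simp
      map_smul' := fun t a => by ext x; exact smul_comm _ _ _ }
    (by ext; simp [Algebra.algebraMap_eq_smul_one])
    (fun a b => WithConv.ext (LinearMap.ext fun c => by
      simp only [LinearMap.coe_mk, AddHom.coe_mk]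
      rw [(ℛ 𝕜 c).convMul_apply]
      simp only [LinearMap.smulRight_apply, smul_mul_smul_comm, ← Finset.sum_smul]
      rw [sum_counit_left]))

theorem rho_mul_kappa {q s : 𝕜ˣ} (hs : s ^ 2 = q) (a a' b : SLq2 q) :
    (rho hs a * kappa q a') b = r hs a b • a' := by
  rw [(ℛ 𝕜 b).convMul_apply]
  have h := sum_counit_right (r hs a).ofConv b
  rw [← h, Finset.sum_smul]
  refine Finset.sum_congr rfl fun i _ => ?_
  simp [rho, kappa, Algebra.algebraMap_eq_smul_one, smul_smul, mul_comm]

theorem kappa_mul_rho {q s : 𝕜ˣ} (hs : s ^ 2 = q) (a a' b : SLq2 q) :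
    (kappa q a' * rho hs a) b = r hs a b • a' := by
  rw [(ℛ 𝕜 b).convMul_apply]
  have h := sum_counit_left (r hs a).ofConv b
  rw [← h, Finset.sum_smul]
  refine Finset.sum_congr rfl fun i _ => ?_
  simp [rho, kappa, Algebra.algebraMap_eq_smul_one, smul_smul, mul_comm]

theorem commute_rho_kappa {q s : 𝕜ˣ} (hs : s ^ 2 = q) (a a' : SLq2 q) :
    Commute (rho hs a) (kappa q a') :=
  WithConv.ext (LinearMap.ext fun b =>
    (rho_mul_kappa hs a a' b).trans (kappa_mul_rho hs a a' b).symm)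

/-- `a ↦ (b ↦ R(a₁ ⊗ b) a₂)`. -/
def Phi {q s : 𝕜ˣ} (hs : s ^ 2 = q) : SLq2 q →ₐ[𝕜] WithConv (SLq2 q →ₗ[𝕜] SLq2 q) :=
  (Algebra.TensorProduct.lift (rho hs) (kappa q) (commute_rho_kappa hs)).comp
    (Bialgebra.comulAlgHom 𝕜 (SLq2 q))

/-- `a ↦ (b ↦ R(a₂ ⊗ b) a₁)`. -/
def Phi' {q s : 𝕜ˣ} (hs : s ^ 2 = q) : SLq2 q →ₐ[𝕜] WithConv (SLq2 q →ₗ[𝕜] SLq2 q) :=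
  (Algebra.TensorProduct.lift (kappa q) (rho hs) fun a b => (commute_rho_kappa hs b a).symm).comp
    (Bialgebra.comulAlgHom 𝕜 (SLq2 q))

theorem Phi_apply {q s : 𝕜ˣ} (hs : s ^ 2 = q) (a b : SLq2 q) {ι : Type*} (ra : Repr 𝕜 a ι) :
    Phi hs a b = ∑ i ∈ ra.index, r hs (ra.left i) b • ra.right i := by
  rw [Phi, AlgHom.comp_apply, Bialgebra.comulAlgHom_apply, ← ra.eq]
  simp only [map_sum, Algebra.TensorProduct.lift_tmul, ofConv_sum, LinearMap.sum_apply,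
    rho_mul_kappa]

theorem Phi'_apply {q s : 𝕜ˣ} (hs : s ^ 2 = q) (a b : SLq2 q) {ι : Type*} (ra : Repr 𝕜 a ι) :
    Phi' hs a b = ∑ i ∈ ra.index, r hs (ra.right i) b • ra.left i := by
  rw [Phi', AlgHom.comp_apply, Bialgebra.comulAlgHom_apply, ← ra.eq]
  simp only [map_sum, Algebra.TensorProduct.lift_tmul, ofConv_sum, LinearMap.sum_apply,
    kappa_mul_rho]

/-- `b ↦ R(T i k ⊗ b₁) b₂`. -/
def xm {q s : 𝕜ˣ} (hs : s ^ 2 = q) (i k : Fin 2) : SLq2 q →ₗ[𝕜] SLq2 q :=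
  (TensorProduct.lid 𝕜 (SLq2 q)).toLinearMap ∘ₗ (ell hs i k).rTensor _ ∘ₗ comul

/-- `b ↦ b₁ R(T i k ⊗ b₂)`. -/
def ym {q s : 𝕜ˣ} (hs : s ^ 2 = q) (i k : Fin 2) : SLq2 q →ₗ[𝕜] SLq2 q :=
  (TensorProduct.rid 𝕜 (SLq2 q)).toLinearMap ∘ₗ (ell hs i k).lTensor _ ∘ₗ comul

theorem xm_apply {q s : 𝕜ˣ} (hs : s ^ 2 = q) (i k : Fin 2) (b : SLq2 q) :
    xm hs i k b = ∑ j ∈ (ℛ 𝕜 b).index, ell hs i k ((ℛ 𝕜 b).left j) • (ℛ 𝕜 b).right j := by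
  rw [xm, LinearMap.comp_apply, LinearMap.comp_apply, ← (ℛ 𝕜 b).eq]
  simp

theorem ym_apply {q s : 𝕜ˣ} (hs : s ^ 2 = q) (i k : Fin 2) (b : SLq2 q) :
    ym hs i k b = ∑ j ∈ (ℛ 𝕜 b).index, ell hs i k ((ℛ 𝕜 b).right j) • (ℛ 𝕜 b).left j := by
  rw [ym, LinearMap.comp_apply, LinearMap.comp_apply, ← (ℛ 𝕜 b).eq]
  simp

theorem xm_mul {q s : 𝕜ˣ} (hs : s ^ 2 = q) (i k : Fin 2) (b c : SLq2 q) :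
    xm hs i k (b * c) = ∑ m, xm hs m k b * xm hs i m c := by
  simp only [xm_apply hs _ _ b, xm_apply hs _ _ c]
  rw [xm, LinearMap.comp_apply, LinearMap.comp_apply, Bialgebra.comul_mul, ← (ℛ 𝕜 b).eq,
    ← (ℛ 𝕜 c).eq]
  simp only [Finset.sum_mul_sum, Algebra.TensorProduct.tmul_mul_tmul, smul_mul_smul_comm]
  simp only [map_sum, LinearMap.rTensor_tmul, ell_mul, LinearEquiv.coe_coe,
    TensorProduct.lid_tmul, Fin.sum_univ_two, ← Finset.sum_add_distrib, ← add_smul]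
  refine Finset.sum_congr rfl fun _ _ => Finset.sum_congr rfl fun _ _ => ?_
  congr 1
  ring

theorem ym_mul {q s : 𝕜ˣ} (hs : s ^ 2 = q) (i k : Fin 2) (b c : SLq2 q) :
    ym hs i k (b * c) = ∑ m, ym hs m k b * ym hs i m c := by
  simp only [ym_apply hs _ _ b, ym_apply hs _ _ c]
  rw [ym, LinearMap.comp_apply, LinearMap.comp_apply, Bialgebra.comul_mul, ← (ℛ 𝕜 b).eq,
    ← (ℛ 𝕜 c).eq]
  simp only [Finset.sum_mul_sum, Algebra.TensorProduct.tmul_mul_tmul, smul_mul_smul_comm]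
  simp only [map_sum, LinearMap.lTensor_tmul, ell_mul, LinearEquiv.coe_coe,
    TensorProduct.rid_tmul, Fin.sum_univ_two, ← Finset.sum_add_distrib, ← add_smul]
  refine Finset.sum_congr rfl fun _ _ => Finset.sum_congr rfl fun _ _ => ?_
  congr 1
  ring

theorem T_xm {q s : 𝕜ˣ} (hs : s ^ 2 = q) (b : SLq2 q) : ∀ i j : Fin 2,
    ∑ k, T q k j * xm hs i k b = ∑ k, ym hs k j b * T q i k := by
  induction b using SLq2.induction with
  | hs t =>
    intro i j
    fin_cases i <;> fin_cases j <;>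
    simp [xm, ym, Algebra.algebraMap_eq_smul_one, Algebra.TensorProduct.one_def, ell_one]
  | hT m n =>
    intro i j
    have hs0 : (s : 𝕜) ≠ 0 := s.ne_zero
    simp only [xm, ym, LinearMap.comp_apply, comul_T]
    have hq : (q : 𝕜) = s ^ 2 := by rw [← hs]; simp
    fin_cases i <;> fin_cases j <;> fin_cases m <;> fin_cases n <;>
    simp [ell_T, rVal, T_ba, T_ca, T_db, T_dc, T_cb, T_ad, T_da, smul_smul, hq] <;>
    match_scalars <;> field_simp <;> ring
  | hm x y hx hy =>
    intro i j
    have h : ∀ i j, T q 0 j * xm hs i 0 x + T q 1 j * xm hs i 1 x =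
        ym hs 0 j x * T q i 0 + ym hs 1 j x * T q i 1 := fun i j => by
      simpa only [Fin.sum_univ_two] using hx i j
    have h' : ∀ i j, T q 0 j * xm hs i 0 y + T q 1 j * xm hs i 1 y =
        ym hs 0 j y * T q i 0 + ym hs 1 j y * T q i 1 := fun i j => by
      simpa only [Fin.sum_univ_two] using hy i j
    simp only [xm_mul, ym_mul, Fin.sum_univ_two]
    calc _ = (T q 0 j * xm hs 0 0 x + T q 1 j * xm hs 0 1 x) * xm hs i 0 y +
          (T q 0 j * xm hs 1 0 x + T q 1 j * xm hs 1 1 x) * xm hs i 1 y := by noncomm_ring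
      _ = ym hs 0 j x * (T q 0 0 * xm hs i 0 y + T q 1 0 * xm hs i 1 y) +
          ym hs 1 j x * (T q 0 1 * xm hs i 0 y + T q 1 1 * xm hs i 1 y) := by
        rw [h, h]; noncomm_ring
      _ = _ := by rw [h', h']; noncomm_ring
  | ha x y hx hy =>
    intro i j
    simp only [map_add, mul_add, add_mul, Finset.sum_add_distrib, hx, hy]

theorem Phi_mul_id {q s : 𝕜ˣ} (hs : s ^ 2 = q) (a : SLq2 q) :
    Phi hs a * toConv LinearMap.id = toConv LinearMap.id * Phi' hs a := by
  induction a using SLq2.induction with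
  | hs t => rw [AlgHom.commutes, AlgHom.commutes, Algebra.commutes]
  | hT i j =>
    refine WithConv.ext (LinearMap.ext fun b => ?_)
    let ra : Repr 𝕜 (T q i j) (Fin 2) :=
      ⟨Finset.univ, fun k => T q i k, fun k => T q k j, (comul_T q i j).symm⟩
    rw [(ℛ 𝕜 b).convMul_apply, (ℛ 𝕜 b).convMul_apply]
    simp only [Phi_apply hs _ _ ra, Phi'_apply hs _ _ ra]
    have h := T_xm hs b i j
    simp only [xm_apply, ym_apply, Finset.mul_sum, Finset.sum_mul] at h
    rw [Finset.sum_comm, Finset.sum_comm (s := Finset.univ) (t := (ℛ 𝕜 b).index)] at h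
    simpa [ra, add_mul, mul_add] using h
  | hm x y hx hy => rw [map_mul, map_mul, mul_assoc, hy, ← mul_assoc, hx, mul_assoc]
  | ha x y hx hy => rw [map_add, map_add, add_mul, mul_add, hx, hy]

/-- The coquasitriangular structure of `SL_q(2)`, the universal `R`-form with values `rVal` on
pairs of generators (see `R_form_T`). -/
def R {q s : 𝕜ˣ} (hs : s ^ 2 = q) : UniversalRForm 𝕜 (SLq2 q) where
  unit := ⟨toConv (rForm hs), toConv (rInv hs), rForm_mul_rInv hs, rInv_mul_rForm hs⟩
  conv_mul := by
    refine WithConv.ext (TensorProduct.ext' fun a b => ?_)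
    have h := congrArg (fun f => f.ofConv b) (Phi_mul_id hs a)
    simp only [(ℛ 𝕜 b).convMul_apply, Phi_apply hs _ _ (ℛ 𝕜 a), Phi'_apply hs _ _ (ℛ 𝕜 a),
      Finset.sum_mul, Finset.mul_sum] at h
    rw [convMul_tmul _ _ a b (ℛ 𝕜 a) (ℛ 𝕜 b), convMul_tmul _ _ a b (ℛ 𝕜 a) (ℛ 𝕜 b),
      Finset.sum_comm, Finset.sum_comm (s := (ℛ 𝕜 a).index)]
    simpa [Algebra.algebraMap_eq_smul_one] using h
  comp_idTensorMul := by
    refine WithConv.ext (TensorProduct.ext' fun a bc => ?_)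
    induction bc with
    | zero => simp
    | add x y hx hy => rw [TensorProduct.tmul_add, map_add, map_add, hx, hy]
    | tmul b c =>
      refine Eq.trans ?_ (leg13_convMul_leg12 _ _ a b c).symm
      refine (r_mul_right hs a b c).trans ?_
      conv_lhs => rw [← (ℛ 𝕜 a).eq]
      simp
  comp_mulTensorId := by
    refine WithConv.ext (TensorProduct.ext' fun a bc => ?_)
    induction bc with
    | zero => simp
    | add x y hx hy => rw [TensorProduct.tmul_add, map_add, map_add, hx, hy]
    | tmul b c =>
      refine Eq.trans ?_ (leg13_convMul_leg23 _ _ a b c).symm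
      exact r_mul_left hs a b c

theorem R_form_T {q s : 𝕜ˣ} (hs : s ^ 2 = q) (i j k l : Fin 2) :
    (R hs).form (T q i j ⊗ₜ T q k l) = rVal q s i j k l := by
  change r hs (T q i j) (T q k l) = _
  rw [r_T]
  exact ell_T hs i j k l

end SLq2

end

/-! The last two axioms are twisted Leibniz rules. Writing `X b` for the matrix `(χ (T i j ⊗ b))ᵢⱼ`,
the axiom for `id ⊗ m` says that `X (b * c)` is `X b * ε c` plus `X c` conjugated by the matrices of
the `R`-form on the coproduct of `b`; the axiom for `m ⊗ id` plays the same role in the left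
argument. Hence `χ` is determined by its sixteen values on pairs of generators, and it vanishes once
they do (`chi_T_tmul`, `chi_one_tmul`, `chi_tmul`). These values are constrained because both sides
of a defining relation of `SL_q(2)` must have the same image (`chi_T_T`). Most relations then read
`(q - 1) x = 0` or `(q ^ 2 - 1) x = 0` for a single value `x`. For the diagonal values, `αδ = 1 +
q⁻¹βγ` in the right argument gives `χ(α⊗α) + χ(α⊗δ) = 0`, while `βα = qαβ` in the left argument,
paired with `γ`, gives `χ(α⊗α) = χ(α⊗δ)`; this is where `2 ≠ 0` enters. The value `χ(β⊗γ)` cancels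
from the relations in which it appears here. It is removed by the commutation axiom `(uχ) * m = m *
(uχ)`, which at `α ⊗ γ` reduces to `χ(β⊗γ) γα = 0`. No basis of the algebra is needed to see that
`γα ≠ 0`: the functional `R(β ⊗ -)` takes the value `q - q⁻¹` on it. -/

noncomputable section

/-! ### Convolution products of leg maps on elementary tensors -/

section Legs

open Coalgebra WithConv

variable {𝕜 H : Type*} [Field 𝕜] [Ring H] [Bialgebra 𝕜 H]

/-- The representations of the coproducts are left free, so that on generators the sums can later be
taken over the two explicit tensors of the matrix coproduct instead of an arbitrary choice. -/
theorem convMul_tmul_tmul_of_repr (f g : WithConv (H ⊗[𝕜] (H ⊗[𝕜] H) →ₗ[𝕜] 𝕜)) (a b c : H)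
    {ι κ μ : Type*} (ra : Repr 𝕜 a ι) (rb : Repr 𝕜 b κ) (rc : Repr 𝕜 c μ) :
    (f * g) (a ⊗ₜ (b ⊗ₜ c)) =
      ∑ i ∈ ra.index, ∑ j ∈ rb.index, ∑ k ∈ rc.index,
        f (ra.left i ⊗ₜ (rb.left j ⊗ₜ rc.left k)) *
          g (ra.right i ⊗ₜ (rb.right j ⊗ₜ rc.right k)) := by
  rw [LinearMap.convMul_apply, TensorProduct.comul_tmul, TensorProduct.comul_tmul]
  conv_lhs => rw [← ra.eq, ← rb.eq, ← rc.eq]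
  simp only [TensorProduct.sum_tmul, TensorProduct.tmul_sum, map_sum,
    TensorProduct.AlgebraTensorModule.tensorTensorTensorComm_tmul, TensorProduct.map_tmul,
    LinearMap.mul'_apply]
  rw [Finset.sum_comm]
  conv_lhs => enter [2, x]; rw [Finset.sum_comm]
  rw [Finset.sum_comm]

/-- Only the first tensor slot is seen by both factors; in the other two slots one factor is `ε`,
and the counit law collapses the coproduct. -/
theorem leg12_convMul_leg13_of_repr (f g : H ⊗[𝕜] H →ₗ[𝕜] 𝕜) (a b c : H) {ι : Type*}
    (ra : Repr 𝕜 a ι) :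
    (toConv (leg12 f) * toConv (leg13 g)) (a ⊗ₜ (b ⊗ₜ c)) =
      ∑ i ∈ ra.index, f (ra.left i ⊗ₜ b) * g (ra.right i ⊗ₜ c) := by
  rw [convMul_tmul_tmul_of_repr _ _ a b c ra (ℛ 𝕜 b) (ℛ 𝕜 c)]
  refine Finset.sum_congr rfl fun i _ => ?_
  have hb := sum_counit_right (f ∘ₗ TensorProduct.mk 𝕜 H H (ra.left i)) b
  have hc := sum_counit_left (g ∘ₗ TensorProduct.mk 𝕜 H H (ra.right i)) c
  simp only [LinearMap.comp_apply, TensorProduct.mk_apply] at hb hc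
  rw [← hb, ← hc, Finset.sum_mul_sum]
  refine Finset.sum_congr rfl fun j _ => Finset.sum_congr rfl fun k _ => ?_
  simp only [leg13_tmul, leg12_tmul]
  ring

theorem leg23_convMul_leg13_of_repr (f g : H ⊗[𝕜] H →ₗ[𝕜] 𝕜) (a b c : H) {ι : Type*}
    (rc : Repr 𝕜 c ι) :
    (toConv (leg23 f) * toConv (leg13 g)) (a ⊗ₜ (b ⊗ₜ c)) =
      ∑ k ∈ rc.index, f (b ⊗ₜ rc.left k) * g (a ⊗ₜ rc.right k) := by
  rw [convMul_tmul_tmul_of_repr _ _ a b c (ℛ 𝕜 a) (ℛ 𝕜 b) rc]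
  refine ((Finset.sum_congr rfl fun i _ => Finset.sum_comm).trans Finset.sum_comm).trans ?_
  refine Finset.sum_congr rfl fun k _ => ?_
  have ha := sum_counit_left (g ∘ₗ (TensorProduct.mk 𝕜 H H).flip (rc.right k)) a
  have hb := sum_counit_right (f ∘ₗ (TensorProduct.mk 𝕜 H H).flip (rc.left k)) b
  simp only [LinearMap.comp_apply, LinearMap.flip_apply, TensorProduct.mk_apply] at ha hb
  rw [← ha, ← hb, Finset.sum_mul_sum, Finset.sum_comm]
  refine Finset.sum_congr rfl fun i _ => Finset.sum_congr rfl fun j _ => ?_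
  simp only [leg13_tmul, leg23_tmul]
  ring

/-- Here `f` is arbitrary, so only the third slot collapses. Since the triple products in the axioms
associate to the left, this serves to split off their last factor. -/
theorem convMul_leg12_of_repr (f : WithConv (H ⊗[𝕜] (H ⊗[𝕜] H) →ₗ[𝕜] 𝕜))
    (g : H ⊗[𝕜] H →ₗ[𝕜] 𝕜) (a b c : H) {ι κ : Type*} (ra : Repr 𝕜 a ι) (rb : Repr 𝕜 b κ) :
    (f * toConv (leg12 g)) (a ⊗ₜ (b ⊗ₜ c)) =
      ∑ i ∈ ra.index, ∑ j ∈ rb.index,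
        f (ra.left i ⊗ₜ (rb.left j ⊗ₜ c)) * g (ra.right i ⊗ₜ rb.right j) := by
  rw [convMul_tmul_tmul_of_repr _ _ a b c ra rb (ℛ 𝕜 c)]
  refine Finset.sum_congr rfl fun i _ => Finset.sum_congr rfl fun j _ => ?_
  have hc := sum_counit_right (f.ofConv ∘ₗ TensorProduct.mk 𝕜 H (H ⊗[𝕜] H) (ra.left i) ∘ₗ
    TensorProduct.mk 𝕜 H H (rb.left j)) c
  simp only [LinearMap.comp_apply, TensorProduct.mk_apply] at hc
  rw [← hc, Finset.sum_mul]
  refine Finset.sum_congr rfl fun k _ => ?_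
  simp only [leg12_tmul]
  ring

theorem convMul_leg23_of_repr (f : WithConv (H ⊗[𝕜] (H ⊗[𝕜] H) →ₗ[𝕜] 𝕜))
    (g : H ⊗[𝕜] H →ₗ[𝕜] 𝕜) (a b c : H) {ι κ : Type*} (rb : Repr 𝕜 b ι) (rc : Repr 𝕜 c κ) :
    (f * toConv (leg23 g)) (a ⊗ₜ (b ⊗ₜ c)) =
      ∑ j ∈ rb.index, ∑ k ∈ rc.index,
        f (a ⊗ₜ (rb.left j ⊗ₜ rc.left k)) * g (rb.right j ⊗ₜ rc.right k) := by
  rw [convMul_tmul_tmul_of_repr _ _ a b c (ℛ 𝕜 a) rb rc, Finset.sum_comm]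
  refine Finset.sum_congr rfl fun j _ => ?_
  rw [Finset.sum_comm]
  refine Finset.sum_congr rfl fun k _ => ?_
  have ha := sum_counit_right (f.ofConv ∘ₗ
    (TensorProduct.mk 𝕜 H (H ⊗[𝕜] H)).flip (rb.left j ⊗ₜ rc.left k)) a
  simp only [LinearMap.comp_apply, LinearMap.flip_apply, TensorProduct.mk_apply] at ha
  rw [← ha, Finset.sum_mul]
  refine Finset.sum_congr rfl fun i _ => ?_
  simp only [leg23_tmul]
  ring

theorem isInfinitesimalRForm_zero (R : UniversalRForm 𝕜 H) :
    IsInfinitesimalRForm R 0 := by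
  have h12 : leg12 (0 : H ⊗[𝕜] H →ₗ[𝕜] 𝕜) = 0 := by simp [leg12]
  have h23 : leg23 (0 : H ⊗[𝕜] H →ₗ[𝕜] 𝕜) = 0 := by simp [leg23]
  have h13 : leg13 (0 : H ⊗[𝕜] H →ₗ[𝕜] 𝕜) = 0 := by simp [leg13, h23]
  constructor <;> simp [h12, h23, h13]

end Legs

/-! ### The twisted Leibniz rules for `χ` -/

namespace SLq2

open Coalgebra WithConv

variable {𝕜 : Type*} [Field 𝕜]

/-- The coproduct of a generator as an explicit sum of two tensors. -/
def reprT (q : 𝕜ˣ) (i j : Fin 2) : Repr 𝕜 (T q i j) (Fin 2) :=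
  ⟨Finset.univ, fun k => T q i k, fun k => T q k j, (comul_T q i j).symm⟩

variable {q s : 𝕜ˣ} {hs : s ^ 2 = q} {χ : SLq2 q ⊗[𝕜] SLq2 q →ₗ[𝕜] 𝕜}

theorem chi_T_mul (h : IsInfinitesimalRForm (R hs) χ) (i j : Fin 2) (b c : SLq2 q)
    {κ : Type*} (rb : Repr 𝕜 b κ) :
    χ (T q i j ⊗ₜ (b * c)) = χ (T q i j ⊗ₜ b) * counit c +
      ∑ v, ∑ m ∈ rb.index, (∑ u, (R hs).invForm (T q i u ⊗ₜ rb.left m) * χ (T q u v ⊗ₜ c)) *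
        (R hs).form (T q v j ⊗ₜ rb.right m) := by
  have h2 := congrArg (fun f => f.ofConv (T q i j ⊗ₜ (b ⊗ₜ c))) h.comp_idTensorMul
  refine h2.trans (congrArg (χ (T q i j ⊗ₜ b) * counit c + ·) ?_)
  refine (convMul_leg12_of_repr _ _ _ _ _ (reprT q i j) rb).trans ?_
  exact Finset.sum_congr rfl fun v _ => Finset.sum_congr rfl fun m _ => congrArg (· * _)
    (leg12_convMul_leg13_of_repr _ _ _ _ _ (reprT q i v))

/-- The third slot meets all three factors `R⁻¹`, `χ`, `R`, so its coproduct is taken twice: `rc`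
splits `c`, and `rl v` splits the left tensor factors again. -/
theorem chi_mul_tmul (h : IsInfinitesimalRForm (R hs) χ) (a b c : SLq2 q) {κ ι ι' : Type*}
    (rb : Repr 𝕜 b κ) (rc : Repr 𝕜 c ι) (rl : ∀ v, Repr 𝕜 (rc.left v) ι') :
    χ ((a * b) ⊗ₜ c) = counit a * χ (b ⊗ₜ c) +
      ∑ m ∈ rb.index, ∑ v ∈ rc.index, (∑ u ∈ (rl v).index,
        (R hs).invForm (rb.left m ⊗ₜ (rl v).left u) * χ (a ⊗ₜ (rl v).right u)) *
          (R hs).form (rb.right m ⊗ₜ rc.right v) := by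
  have h3 := congrArg (fun f => f.ofConv (a ⊗ₜ (b ⊗ₜ c))) h.comp_mulTensorId
  refine h3.trans (congrArg (counit a * χ (b ⊗ₜ c) + ·) ?_)
  refine (convMul_leg23_of_repr _ _ _ _ _ rb rc).trans ?_
  exact Finset.sum_congr rfl fun m _ => Finset.sum_congr rfl fun v _ => congrArg (· * _)
    (leg23_convMul_leg13_of_repr _ _ _ _ _ (rl v))

/-- Every term of the Leibniz rule contains a value `χ (b ⊗ -)` or `χ (a ⊗ -)`. -/
theorem chi_mul_tmul_eq_zero (h : IsInfinitesimalRForm (R hs) χ) {a b : SLq2 q}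
    (ha : ∀ c, χ (a ⊗ₜ c) = 0) (hb : ∀ c, χ (b ⊗ₜ c) = 0) (c : SLq2 q) :
    χ ((a * b) ⊗ₜ c) = 0 := by
  simp [chi_mul_tmul h a b c (ℛ 𝕜 b) (ℛ 𝕜 c) (fun v => ℛ 𝕜 ((ℛ 𝕜 c).left v)), ha, hb]

/-! ### Values of `χ` on pairs of generators -/

/-- The values `R⁻¹ (T i j ⊗ T k l)` on generators. -/
def rInvVal (q s : 𝕜ˣ) (i j k l : Fin 2) : 𝕜 :=
  ![![rVal q s 1 1 k l, -(q : 𝕜) * rVal q s 0 1 k l],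
    ![-(q : 𝕜)⁻¹ * rVal q s 1 0 k l, rVal q s 0 0 k l]] i j

/-- The inverse form is `R ∘ (S ⊗ id)`, so its values come from the antipode matrix. -/
theorem R_invForm_T (hs : s ^ 2 = q) (i j k l : Fin 2) :
    (R hs).invForm (T q i j ⊗ₜ T q k l) = rInvVal q s i j k l := by
  change (r hs (S q (T q i j))) (T q k l) = _
  rw [S_T]
  fin_cases i <;> fin_cases j <;> simp [rInvVal, ell_T]

theorem chi_T_mul_T (h : IsInfinitesimalRForm (R hs) χ) (i j k l m n : Fin 2) :
    χ (T q i j ⊗ₜ (T q k l * T q m n)) = χ (T q i j ⊗ₜ T q k l) * (if m = n then 1 else 0) +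
      ∑ v, ∑ w, (∑ u, rInvVal q s i u k w * χ (T q u v ⊗ₜ T q m n)) * rVal q s v j w l := by
  rw [chi_T_mul h i j _ _ (reprT q k l), counit_T]
  simp only [reprT, R_invForm_T, R_form_T]

theorem chi_mul_T_T (h : IsInfinitesimalRForm (R hs) χ) (i j k l m n : Fin 2) :
    χ ((T q i j * T q k l) ⊗ₜ T q m n) = (if i = j then 1 else 0) * χ (T q k l ⊗ₜ T q m n) +
      ∑ w, ∑ v, (∑ u, rInvVal q s k w m u * χ (T q i j ⊗ₜ T q u v)) * rVal q s w l v n := by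
  rw [chi_mul_tmul h _ _ _ (reprT q k l) (reprT q m n) (fun v => reprT q m v), counit_T]
  simp only [reprT, R_invForm_T, R_form_T]

/-- As for derivations: the Leibniz rule at `1 * 1` has trivial conjugation, so the value equals
twice itself. -/
theorem chi_tmul_one (h : IsInfinitesimalRForm (R hs) χ) (i j : Fin 2) :
    χ (T q i j ⊗ₜ 1) = 0 := by
  have hone (i j : Fin 2) : (R hs).form (T q i j ⊗ₜ 1) = if i = j then 1 else 0 :=
    (r_one_right hs (T q i j)).trans (counit_T q i j)
  have hinv (i j : Fin 2) : (R hs).invForm (T q i j ⊗ₜ 1) = if i = j then 1 else 0 := by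
    change (r hs (S q (T q i j))) 1 = _
    rw [r_one_right, S_T]
    fin_cases i <;> fin_cases j <;> simp [counit_T]
  have h1 := chi_T_mul h i j 1 1 (κ := Unit) ⟨{()}, fun _ => 1, fun _ => 1, by
    simp [Algebra.TensorProduct.one_def]⟩
  simpa [hone, hinv] using h1

theorem sum_chi_smul_T_mul_T (h : IsInfinitesimalRForm (R hs) χ) (i j k l : Fin 2) :
    ∑ m, ∑ n, χ (T q i m ⊗ₜ T q k n) • (T q m j * T q n l) =
      ∑ m, ∑ n, χ (T q m j ⊗ₜ T q n l) • (T q i m * T q k n) := by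
  have h1 := congrArg (fun f => f.ofConv (T q i j ⊗ₜ T q k l)) h.conv_mul
  simp only [convMul_tmul _ _ _ _ (reprT q i j) (reprT q k l)] at h1
  simpa [reprT, Algebra.algebraMap_eq_smul_one] using h1

/-- The compatibility of `χ` with the quadratic relations forces every value on generators, except
`χ (β ⊗ γ)`, to vanish; the latter is killed by `(uχ) * m = m * (uχ)`. -/
theorem chi_T_T (h2 : (2 : 𝕜) ≠ 0) (hq₁ : (q : 𝕜) ≠ 1) (hq₂ : (q : 𝕜) ≠ -1)
    (h : IsInfinitesimalRForm (R hs) χ) (i j k l : Fin 2) : χ (T q i j ⊗ₜ T q k l) = 0 := by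
  have hs0 : (s : 𝕜) ≠ 0 := s.ne_zero
  have hq : (q : 𝕜) = s ^ 2 := by rw [← hs]; simp
  -- In terms of `s`, the coefficients to be cancelled are `q - 1` and `q ^ 2 - 1`, up to powers of
  -- `s` and a factor 2.
  have hm : (s : 𝕜) ^ 2 - 1 ≠ 0 := by rwa [← hq, sub_ne_zero]
  have hp : (s : 𝕜) ^ 2 + 1 ≠ 0 := by rwa [← hq, ← sub_neg_eq_add, sub_ne_zero]
  have hpm : (s : 𝕜) ^ 4 - 1 ≠ 0 := by
    rw [show (s : 𝕜) ^ 4 - 1 = (s ^ 2 - 1) * (s ^ 2 + 1) by ring]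
    exact mul_ne_zero hm hp
  have right (i j : Fin 2) {x y : SLq2 q} (hxy : x = y) : χ (T q i j ⊗ₜ x) = χ (T q i j ⊗ₜ y) :=
    congrArg (fun z => χ (T q i j ⊗ₜ z)) hxy
  have left (k l : Fin 2) {x y : SLq2 q} (hxy : x = y) : χ (x ⊗ₜ T q k l) = χ (y ⊗ₜ T q k l) :=
    congrArg (fun z => χ (z ⊗ₜ T q k l)) hxy
  -- The `r` equations put a relation in the right argument of `χ`, the `l` equations in the left
  -- one; after expansion each is linear in the values on generators.
  have r1 := right 0 0 (T_ba q)
  have r2 := right 1 0 (T_ba q)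
  have r3 := right 1 1 (T_ba q)
  have r4 := right 0 0 (T_ca q)
  have r5 := right 0 1 (T_ca q)
  have r6 := right 1 0 (T_ca q)
  have r7 := right 1 1 (T_ca q)
  have r8 := right 0 0 (T_ad q)
  have r9 := right 1 1 (T_ad q)
  have l1 := left 0 0 (T_ba q)
  have l2 := left 0 1 (T_ba q)
  have l3 := left 1 0 (T_ba q)
  have l4 := left 1 1 (T_ba q)
  have l5 := left 0 0 (T_ca q)
  have l6 := left 1 1 (T_ca q)
  simp only [TensorProduct.tmul_smul, ← TensorProduct.smul_tmul', TensorProduct.tmul_add, map_add,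
    map_smul, smul_eq_mul, chi_T_mul_T h, chi_mul_T_T h, rInvVal, rVal, Fin.sum_univ_two,
    chi_tmul_one h] at r1 r2 r3 r4 r5 r6 r7 r8 r9 l1 l2 l3 l4 l5 l6
  simp at r1 r2 r3 r4 r5 r6 r7 r8 r9 l1 l2 l3 l4 l5 l6
  rw [hq] at r1 r2 r3 r4 r5 r6 r7 r8 r9 l1 l2 l3 l4 l5 l6
  field_simp at r1 r2 r3 r4 r5 r6 r7 r8 r9 l1 l2 l3 l4 l5 l6
  -- These seven equations each involve a single unknown.
  have z0001 : χ (T q 0 0 ⊗ₜ T q 0 1) = 0 :=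
    (mul_eq_zero_iff_left hm).1 (by linear_combination -r1)
  have z1001 : χ (T q 1 0 ⊗ₜ T q 0 1) = 0 :=
    (mul_eq_zero_iff_left hpm).1 (by linear_combination -r2)
  have z1101 : χ (T q 1 1 ⊗ₜ T q 0 1) = 0 :=
    (mul_eq_zero_iff_left hm).1 (by linear_combination -r3)
  have z1010 : χ (T q 1 0 ⊗ₜ T q 1 0) = 0 :=
    (mul_eq_zero_iff_left hpm).1 (by linear_combination -r6)
  have z0101 : χ (T q 0 1 ⊗ₜ T q 0 1) = 0 :=
    (mul_eq_zero_iff_left hpm).1 (by linear_combination -l2)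
  have z1000 : χ (T q 1 0 ⊗ₜ T q 0 0) = 0 :=
    (mul_eq_zero_iff_left hm).1 (by linear_combination -l5)
  have z1011 : χ (T q 1 0 ⊗ₜ T q 1 1) = 0 :=
    (mul_eq_zero_iff_left hm).1 (by linear_combination -l6)
  -- The next four equations carry a second unknown, `χ(γ⊗α)` or `χ(α⊗β)`, which is already known to
  -- vanish.
  rw [z1000] at r4 r7
  rw [z0001] at l1 l4
  have z0010 : χ (T q 0 0 ⊗ₜ T q 1 0) = 0 :=
    (mul_eq_zero_iff_left hm).1 (by linear_combination -r4)
  have z1110 : χ (T q 1 1 ⊗ₜ T q 1 0) = 0 :=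
    (mul_eq_zero_iff_left (mul_ne_zero (pow_ne_zero 4 hs0) hm)).1 (by linear_combination -r7)
  have z0100 : χ (T q 0 1 ⊗ₜ T q 0 0) = 0 :=
    (mul_eq_zero_iff_left (mul_ne_zero (pow_ne_zero 2 hs0) hm)).1 (by linear_combination -l1)
  have z0111 : χ (T q 0 1 ⊗ₜ T q 1 1) = 0 :=
    (mul_eq_zero_iff_left hm).1 (by linear_combination -l4)
  -- In `l3` the terms `χ(β⊗γ)` cancel, leaving `χ(α⊗δ) = χ(α⊗α)` times `q ^ 2 - 1`; `r8` says that
  -- these two values sum to zero.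
  have z0000 : χ (T q 0 0 ⊗ₜ T q 0 0) = 0 :=
    (mul_eq_zero_iff_left (mul_ne_zero h2 hpm)).1
      (by linear_combination l3 + ((s : 𝕜) ^ 4 - 1) * r8)
  have z0011 : χ (T q 0 0 ⊗ₜ T q 1 1) = 0 := by linear_combination r8 - z0000
  -- Again `χ(β⊗γ)` cancels in `r5`, which identifies `χ(δ⊗α)` with `χ(α⊗α)`.
  have z1100 : χ (T q 1 1 ⊗ₜ T q 0 0) = 0 :=
    (mul_eq_zero_iff_left hpm).1 (by linear_combination -r5 + ((s : 𝕜) ^ 4 - 1) * z0000)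
  have z1111 : χ (T q 1 1 ⊗ₜ T q 1 1) = 0 := by linear_combination r9 - z1100
  have z0110 : χ (T q 0 1 ⊗ₜ T q 1 0) = 0 := by
    -- At `α ⊗ γ` the only surviving term is `χ(β⊗γ) γα`, and `R(β ⊗ γα) = R(α⊗α) R(β⊗γ) = q - q⁻¹`.
    have h1 := congrArg (ell hs 0 1) (sum_chi_smul_T_mul_T h 0 0 1 0)
    simp only [Fin.sum_univ_two, map_add, map_smul, z0000, z0010, z0011, z0111, z1000,
      z1010] at h1
    simp [ell_mul, ell_T, rVal, hs0] at h1
    refine h1.resolve_right fun h3 => hpm ?_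
    rw [hq] at h3
    field_simp at h3
    linear_combination h3
  fin_cases i <;> fin_cases j <;> fin_cases k <;> fin_cases l <;> assumption

/-! ### From generators to the whole algebra -/

/-- The induction on `b` has to treat all `i`, `j` at once, because conjugation by the `R`-form
mixes the matrix entries. -/
theorem chi_T_tmul (h : IsInfinitesimalRForm (R hs) χ)
    (hT : ∀ i j k l, χ (T q i j ⊗ₜ T q k l) = 0) (b : SLq2 q) :
    ∀ i j, χ (T q i j ⊗ₜ b) = 0 := by
  induction b using SLq2.induction with
  | hs t =>
    intro i j
    rw [Algebra.algebraMap_eq_smul_one, TensorProduct.tmul_smul, map_smul, chi_tmul_one h,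
      smul_zero]
  | hT k l => exact fun i j => hT i j k l
  | hm x y hx hy =>
    intro i j
    simp [chi_T_mul h i j x y (ℛ 𝕜 x), hx, hy]
  | ha x y hx hy =>
    intro i j
    rw [TensorProduct.tmul_add, map_add, hx, hy, add_zero]

/-- The determinant relation writes `1` as `αδ - q⁻¹βγ`, a combination of products of generators, on
which `χ` vanishes by the Leibniz rule. -/
theorem chi_one_tmul (h : IsInfinitesimalRForm (R hs) χ)
    (hT : ∀ i j b, χ (T q i j ⊗ₜ b) = 0) (b : SLq2 q) : χ (1 ⊗ₜ b) = 0 := by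
  have h1 := congrArg (fun x => χ (x ⊗ₜ b)) (T_ad q)
  simpa [TensorProduct.add_tmul, ← TensorProduct.smul_tmul',
    chi_mul_tmul_eq_zero h (hT _ _) (hT _ _)] using h1.symm

theorem chi_tmul (h : IsInfinitesimalRForm (R hs) χ)
    (hT : ∀ i j b, χ (T q i j ⊗ₜ b) = 0) (a : SLq2 q) : ∀ b, χ (a ⊗ₜ b) = 0 := by
  induction a using SLq2.induction with
  | hs t =>
    intro b
    rw [Algebra.algebraMap_eq_smul_one, ← TensorProduct.smul_tmul', map_smul,
      chi_one_tmul h hT, smul_zero]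
  | hT i j => exact hT i j
  | hm x y hx hy => exact chi_mul_tmul_eq_zero h hx hy
  | ha x y hx hy =>
    intro b
    rw [TensorProduct.add_tmul, map_add, hx, hy, add_zero]

end SLq2

end

theorem mainTheorem12 (q : ℂˣ) (hq₁ : q ≠ 1) (hq₂ : q ≠ -1) (s : ℂˣ) (hs : s ^ 2 = q)
    (χ : SLq2 q ⊗[ℂ] SLq2 q →ₗ[ℂ] ℂ) :
    IsInfinitesimalRForm (SLq2.R hs) χ ↔ χ = 0 := by
  refine ⟨fun h => TensorProduct.ext' fun a b => ?_, fun h => ?_⟩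
  · have hT := SLq2.chi_T_T two_ne_zero (fun h1 => hq₁ (Units.ext h1))
      (fun h1 => hq₂ (Units.ext h1)) h
    exact SLq2.chi_tmul h (fun i j b => SLq2.chi_T_tmul h hT b i j) a b
  · subst h
    exact isInfinitesimalRForm_zero _
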